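/- Let $n\ge 1$, $0<s<1$, $1<p<\infty$, $q\ge p-1$, let $B_1$ be the open unit ball of $\mathbb{R}^n$ centred at the origin, and let $$(-\Delta)^s_p u(x)=C_{n,sp}\,\lim_{\varepsilon\to 0^+}\int_{\mathbb{R}^n\setminus B_\varepsilon(x)}\frac{|u(x)-u(y)|^{p-2}\,[u(x)-u(y)]}{|x-y|^{n+sp}}\,dy ,$$ where $C_{n,sp}$ is any fixed positive constant. Let $u:\mathbb{R}^n\to\mathbb{R}$ be such that $u\in C^{1,1}_{\mathrm{loc}}(B_1)$ (that is, $u$ is differentiable in $B_1$ and its gradient is locally Lipschitz there), $u$ is continuous on $\overline{B_1}$, $u>0$ in $B_1$, and $$\begin{cases}(-\Delta)^s_p u(x)=u(x)^q, & x\in B_1,\\ u(x)=0, & x\notin B_1,\end{cases}$$ where the first equation means that for every $x\in B_1$ the limit defining $(-\Delta)^s_p u(x)$ exists and equals $u(x)^q$. Then $u$ is radially symmetric and monotone decreasing about the origin: $u(x)=u(y)$ whenever $|x|=|y|$, and $u(x)>u(y)$ whenever $|x|<1$ and $|x|<|y|$. -/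

import Mathlib

open Filter Topology MeasureTheory Metric Set

noncomputable section

/-- `u` is of class `C^{1,1}_loc` on the open set `U`: it is differentiable on `U` and its
derivative is locally Lipschitz on `U`. -/
def IsC11Loc {n : ℕ} (u : EuclideanSpace ℝ (Fin n) → ℝ)
    (U : Set (EuclideanSpace ℝ (Fin n))) : Prop :=
  DifferentiableOn ℝ u U ∧ LocallyLipschitzOn U (fderiv ℝ u)

/-- The integrand `|u(x) - u(y)|^(p-2) (u(x) - u(y)) / |x - y|^(n + s p)` of the fractional
`p`-Laplacian. When `u x = u y` its value is `0`, for every `p`. -/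
def fracPLapIntegrand {n : ℕ} (s p : ℝ) (u : EuclideanSpace ℝ (Fin n) → ℝ)
    (x y : EuclideanSpace ℝ (Fin n)) : ℝ :=
  |u x - u y| ^ (p - 2) * (u x - u y) / ‖x - y‖ ^ ((n : ℝ) + s * p)

/-- `HasFracPLaplacianAt C s p u x L` says that the fractional `p`-Laplacian of `u` at `x`, with
normalization constant `C`, exists as a principal value and equals `L`: the truncated
integrals over the complements of the balls of radius `ε` around `x` converge absolutely, and
`C` times these integrals tends to `L` as `ε` decreases to `0`. -/
def HasFracPLaplacianAt {n : ℕ} (C s p : ℝ) (u : EuclideanSpace ℝ (Fin n) → ℝ)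
    (x : EuclideanSpace ℝ (Fin n)) (L : ℝ) : Prop :=
  (∀ ε : ℝ, 0 < ε → IntegrableOn (fracPLapIntegrand s p u x) (ball x ε)ᶜ volume) ∧
    Tendsto (fun ε : ℝ => C * ∫ y in (ball x ε)ᶜ, fracPLapIntegrand s p u x y)
      (𝓝[>] 0) (𝓝 L)

end

open scoped RealInnerProductSpace

/-! ### The odd power `|t| ^ (p - 2) * t` -/

/-! This is the direct method of moving planes. For a unit vector `e`, let `x'` be the reflection of
`x` across the plane at height `l` and put `w x = u x' - u x`. The claim is `w ≥ 0` below the plane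
for every `l` from `-1` to `0`. At `l = 0`, with all directions `e`, this gives symmetry; the strict
version for `l < 0` gives monotonicity.

The good `l` form a closed set containing `-1`, so it suffices that a good `l₀ < 0` has good
neighbours. Otherwise `w` has a negative minimum `x` for some `l` near `l₀`. There, pairing each `y`
with `y'` makes the integrand of the difference of the two fractional `p`-Laplacians nonpositive
(`reflectedDiff_add_le`), and `two_mul_sub_le_neg_measure` turns a strict bound on a set into a
strict drop. By compactness it is enough to exclude such minima near each `x₀` of the closed ball.
Strictly below the plane, `w > 0` by the strong maximum principle. On the plane and the sphere, the
nearby zero set of `u` forces a drop of order `r ^ (-(s * p))`, too large when `q ≥ p - 1`. On the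
plane inside the ball, a Hopf-type drop linear in the distance to the plane contradicts the
quadratic smallness of `w` coming from `C^{1,1}` regularity. -/

/-- The odd power function `t ↦ |t| ^ (p - 2) * t`. -/
noncomputable def signedPow (p t : ℝ) : ℝ := |t| ^ (p - 2) * t

/-- Splitting into positive and negative parts removes the singular factor `|t| ^ (p - 2)` of the
range `p < 2`; continuity and monotonicity are then read off for all `p > 1`. -/
theorem signedPow_eq {p : ℝ} (hp : 1 < p) (t : ℝ) :
    signedPow p t = (max t 0) ^ (p - 1) - (max (-t) 0) ^ (p - 1) := by
  unfold signedPow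
  have hp1 : p - 1 ≠ 0 := by linarith
  have key : ∀ t : ℝ, 0 < t → t ^ (p - 2) * t = t ^ (p - 1) := fun t ht => by
    rw [show p - 1 = p - 2 + 1 by ring, Real.rpow_add_one ht.ne']
  rcases lt_trichotomy t 0 with h | h | h
  · have := key (-t) (by linarith)
    rw [abs_of_neg h, max_eq_right h.le, max_eq_left (by linarith), Real.zero_rpow hp1]
    linarith
  · simp [h]
  · rw [abs_of_pos h, max_eq_left h.le, max_eq_right (by linarith), Real.zero_rpow hp1, key t h]
    ring

theorem continuous_signedPow {p : ℝ} (hp : 1 < p) :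
    Continuous (signedPow p) := by
  rw [funext (signedPow_eq hp)]
  exact ((continuous_id.max continuous_const).rpow_const fun _ => Or.inr (by linarith)).sub
    ((continuous_neg.max continuous_const).rpow_const fun _ => Or.inr (by linarith))

theorem strictMono_signedPow {p : ℝ} (hp : 1 < p) :
    StrictMono (signedPow p) := by
  intro a b hab
  simp only [signedPow_eq hp]
  have hp1 : 0 < p - 1 := by linarith
  have h1 : (max a 0) ^ (p - 1) ≤ (max b 0) ^ (p - 1) :=
    Real.rpow_le_rpow (le_max_right _ _) (max_le_max_right _ hab.le) hp1.le
  have h2 : (max (-b) 0) ^ (p - 1) ≤ (max (-a) 0) ^ (p - 1) :=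
    Real.rpow_le_rpow (le_max_right _ _) (max_le_max_right _ (by linarith)) hp1.le
  rcases lt_or_ge 0 b with hb | hb
  · have : (max a 0) ^ (p - 1) < (max b 0) ^ (p - 1) :=
      Real.rpow_lt_rpow (le_max_right _ _) (by simp [hab, hb]) hp1
    linarith
  · have : (max (-b) 0) ^ (p - 1) < (max (-a) 0) ^ (p - 1) :=
      Real.rpow_lt_rpow (le_max_right _ _)
        (by rw [max_eq_left (by linarith : 0 ≤ -b)]; exact lt_max_of_lt_left (by linarith)) hp1
    linarith

theorem signedPow_of_nonneg {p t : ℝ} (hp : 1 < p) (ht : 0 ≤ t) :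
    signedPow p t = t ^ (p - 1) := by
  rw [signedPow_eq hp, max_eq_left ht, max_eq_right (by linarith),
    Real.zero_rpow (by linarith : p - 1 ≠ 0), sub_zero]

/-! ### Inequalities for real powers -/

/-- Bernoulli's inequality for `b / a`, that is, convexity of `t ↦ t ^ θ`. -/
theorem rpow_sub_rpow_le {θ a b : ℝ} (hθ : 1 ≤ θ) (ha : 0 < a) (hb : 0 ≤ b) :
    a ^ θ - b ^ θ ≤ θ * a ^ (θ - 1) * (a - b) := by
  have h := one_add_mul_self_le_rpow_one_add (s := (b - a) / a) (p := θ)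
    (by rw [le_div_iff₀ ha]; linarith) hθ
  have e1 : 1 + (b - a) / a = b / a := by field_simp; ring
  rw [e1, Real.div_rpow hb ha.le, le_div_iff₀ (Real.rpow_pos_of_pos ha _)] at h
  have e2 : a ^ θ = a ^ (θ - 1) * a := by
    rw [← Real.rpow_add_one ha.ne']; ring_nf
  have e3 : (1 + θ * ((b - a) / a)) * a ^ θ = a ^ θ + θ * a ^ (θ - 1) * (b - a) := by
    rw [e2]; field_simp
  linarith

/-- Since `q ≥ p - 1`, `t ^ q` is a power at least `1` of `t ^ (p - 1)`, hence Lipschitz as a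
function of it on bounded sets, even near `t = 0`. This lets the narrow region argument absorb the
right-hand side. -/
theorem rpow_sub_rpow_le_mul {p q U a b : ℝ} (hp : 1 < p) (hq : p - 1 ≤ q) (hb : 0 ≤ b)
    (hba : b ≤ a) (ha : 0 < a) (haU : a ≤ U) :
    a ^ q - b ^ q ≤ q / (p - 1) * U ^ (q - (p - 1)) * (a ^ (p - 1) - b ^ (p - 1)) := by
  have hp1 : 0 < p - 1 := by linarith
  have hmul : (p - 1) * (q / (p - 1)) = q := by field_simp
  have hθ : 1 ≤ q / (p - 1) := by rwa [one_le_div hp1]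
  have h := rpow_sub_rpow_le hθ (Real.rpow_pos_of_pos ha (p - 1)) (Real.rpow_nonneg hb (p - 1))
  rw [← Real.rpow_mul ha.le, ← Real.rpow_mul hb, ← Real.rpow_mul ha.le, hmul, mul_sub (p - 1), hmul,
    mul_one] at h
  refine h.trans ?_
  have h1 : b ^ (p - 1) ≤ a ^ (p - 1) := Real.rpow_le_rpow hb hba hp1.le
  have h2 : a ^ (q - (p - 1)) ≤ U ^ (q - (p - 1)) := Real.rpow_le_rpow ha.le haU (by linarith)
  have : 0 ≤ a ^ (p - 1) - b ^ (p - 1) := by linarith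
  gcongr

/-- The tangent line inequality for `t ↦ t ^ (-b)`. -/
theorem mul_le_rpow_neg_sub_rpow_neg {b A B : ℝ} (hb : 0 ≤ b) (hA : 0 < A) (hB : 0 < B) :
    b * B ^ (-b - 1) * (B - A) ≤ A ^ (-b) - B ^ (-b) := by
  have h1 : A ^ (-b) = B ^ (-b) * Real.exp (b * Real.log (B / A)) := by
    rw [Real.rpow_def_of_pos hA, Real.rpow_def_of_pos hB, ← Real.exp_add,
      Real.log_div hB.ne' hA.ne']
    ring_nf
  have h2 := Real.add_one_le_exp (b * Real.log (B / A))
  have h3 := Real.one_sub_inv_le_log_of_pos (div_pos hB hA)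
  have h4 : 0 < B ^ (-b) := Real.rpow_pos_of_pos hB _
  have h5 : b * (1 - (B / A)⁻¹) ≤ b * Real.log (B / A) := by gcongr
  have h6 : b * B ^ (-b - 1) * (B - A) = B ^ (-b) * (b * (1 - (B / A)⁻¹)) := by
    rw [Real.rpow_sub_one hB.ne', inv_div]; field_simp
  rw [h1, h6]
  nlinarith

/-! ### Reflection across an affine hyperplane -/

section Reflection

variable {V : Type*} [NormedAddCommGroup V] [InnerProductSpace ℝ V]

/-- The reflection across the hyperplane `{y | ⟪e, y⟫ = l}`, for a unit vector `e`. -/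
def planeReflection (e : V) (l : ℝ) (y : V) : V := y + (2 * (l - ⟪e, y⟫)) • e

variable {e : V}

theorem inner_planeReflection (he : ‖e‖ = 1) (l : ℝ) (y : V) :
    ⟪e, planeReflection e l y⟫ = 2 * l - ⟪e, y⟫ := by
  simp only [planeReflection, inner_add_right, inner_smul_right, real_inner_self_eq_norm_sq, he]
  ring

theorem planeReflection_involutive (he : ‖e‖ = 1) (l : ℝ) :
    Function.Involutive (planeReflection e l) := by
  intro y
  rw [planeReflection, inner_planeReflection he, planeReflection, add_assoc, ← add_smul]
  ring_nf
  simp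

/-- The gap between the squared distances is a product of signed distances to the plane. Its sign
compares the kernels in every maximum principle, and its size gives the linear rate in the Hopf
estimate. -/
theorem norm_sub_planeReflection_sq (he : ‖e‖ = 1) (l : ℝ) (x y : V) :
    ‖x - planeReflection e l y‖ ^ 2 = ‖x - y‖ ^ 2 + 4 * (l - ⟪e, x⟫) * (l - ⟪e, y⟫) := by
  rw [planeReflection, ← sub_sub, norm_sub_sq_real, norm_smul, he, inner_smul_right,
    inner_sub_left, real_inner_comm, real_inner_comm e y, mul_one, Real.norm_eq_abs, sq_abs,
    real_inner_comm e x]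
  ring

theorem norm_planeReflection_sq (he : ‖e‖ = 1) (l : ℝ) (y : V) :
    ‖planeReflection e l y‖ ^ 2 = ‖y‖ ^ 2 + 4 * l * (l - ⟪e, y⟫) := by
  simpa using norm_sub_planeReflection_sq he l 0 y

theorem norm_planeReflection_sub (he : ‖e‖ = 1) (l : ℝ) (x y : V) :
    ‖planeReflection e l x - planeReflection e l y‖ = ‖x - y‖ := by
  have h := norm_sub_planeReflection_sq he l (planeReflection e l x) y
  rw [inner_planeReflection he, norm_sub_rev _ y, norm_sub_planeReflection_sq he l y x,
    norm_sub_rev y x] at h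
  exact (sq_eq_sq₀ (norm_nonneg _) (norm_nonneg _)).1 (by linarith)

theorem norm_planeReflection_sub' (he : ‖e‖ = 1) (l : ℝ) (x y : V) :
    ‖planeReflection e l x - y‖ = ‖x - planeReflection e l y‖ := by
  conv_lhs => rw [← planeReflection_involutive he l y]
  exact norm_planeReflection_sub he l x _

theorem continuous_planeReflection (e : V) :
    Continuous fun z : ℝ × V => planeReflection e z.1 z.2 := by
  unfold planeReflection; fun_prop

theorem planeReflection_of_inner_eq {l : ℝ} {y : V} (h : ⟪e, y⟫ = l) :
    planeReflection e l y = y := by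
  simp [planeReflection, h]

theorem le_norm_sub_planeReflection (he : ‖e‖ = 1) (l : ℝ) (x y : V) :
    (l - ⟪e, x⟫) + (l - ⟪e, y⟫) ≤ ‖x - planeReflection e l y‖ := by
  have h := real_inner_le_norm e (planeReflection e l y - x)
  rw [inner_sub_right, inner_planeReflection he, he, one_mul, norm_sub_rev] at h
  linarith

theorem norm_planeReflection_lt_one (he : ‖e‖ = 1) {l : ℝ} (hl : l ≤ 0) {x : V}
    (hx : ⟪e, x⟫ ≤ l) (h1 : ‖x‖ < 1) : ‖planeReflection e l x‖ < 1 := by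
  have h := norm_planeReflection_sq he l x
  have h2 : l * (l - ⟪e, x⟫) ≤ 0 := mul_nonpos_of_nonpos_of_nonneg hl (by linarith)
  nlinarith [norm_nonneg x, norm_nonneg (planeReflection e l x)]

theorem norm_planeReflection_lt_one' (he : ‖e‖ = 1) {l : ℝ} (hl : l < 0) {x : V}
    (hx : ⟪e, x⟫ < l) (h1 : ‖x‖ ≤ 1) : ‖planeReflection e l x‖ < 1 := by
  have h := norm_planeReflection_sq he l x
  have h2 : l * (l - ⟪e, x⟫) < 0 := mul_neg_of_neg_of_pos hl (by linarith)
  nlinarith [norm_nonneg x, norm_nonneg (planeReflection e l x)]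

end Reflection

theorem measurePreserving_planeReflection {n : ℕ} {e : EuclideanSpace ℝ (Fin n)} (he : ‖e‖ = 1)
    (l : ℝ) : MeasurePreserving (planeReflection e l) := by
  -- The affine reflection is the linear one (level `0`) followed by translation by `(2 * l) • e`.
  let A : EuclideanSpace ℝ (Fin n) ≃ₗᵢ[ℝ] EuclideanSpace ℝ (Fin n) :=
    { toLinearEquiv := LinearEquiv.ofInvolutive
        (LinearMap.id - (2 : ℝ) • (innerₗ _ e).smulRight e) (by
          intro y
          simp [inner_sub_right, inner_smul_right, he]
          module)
      norm_map' := by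
        intro y
        have := norm_planeReflection_sub he 0 y 0
        simpa [planeReflection, sub_eq_add_neg, mul_smul] using this }
  have h := (measurePreserving_add_right volume ((2 * l) • e)).comp A.measurePreserving
  have hfun : planeReflection e l = (fun x => x + (2 * l) • e) ∘ A := by
    funext y
    change _ = (y - (2 : ℝ) • (⟪e, y⟫ • e)) + (2 * l) • e
    rw [planeReflection, smul_smul, mul_sub, sub_smul]
    abel
  rw [hfun]
  exact h

theorem measurableEmbedding_planeReflection {n : ℕ} {e : EuclideanSpace ℝ (Fin n)} (he : ‖e‖ = 1)
    (l : ℝ) : MeasurableEmbedding (planeReflection e l) :=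
  (MeasurableEquiv.ofInvolutive _ (planeReflection_involutive he l)
    (measurePreserving_planeReflection he l).measurable).measurableEmbedding

/-! ### The antisymmetrized integrand -/

/-- The integrand of the difference between the fractional `p`-Laplacians of the reflection
of `u` and of `u` itself. -/
noncomputable def reflectedDiff {n : ℕ} (s p : ℝ) (u : EuclideanSpace ℝ (Fin n) → ℝ)
    (e : EuclideanSpace ℝ (Fin n)) (l : ℝ) (x y : EuclideanSpace ℝ (Fin n)) : ℝ :=
  fracPLapIntegrand s p u (planeReflection e l x) (planeReflection e l y) -
    fracPLapIntegrand s p u x y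

section Symmetrized

variable {n : ℕ} {s p l : ℝ} {u : EuclideanSpace ℝ (Fin n) → ℝ} {e x : EuclideanSpace ℝ (Fin n)}

theorem reflectedDiff_eq (he : ‖e‖ = 1) (y : EuclideanSpace ℝ (Fin n)) :
    reflectedDiff s p u e l x y =
      (signedPow p (u (planeReflection e l x) - u (planeReflection e l y)) -
        signedPow p (u x - u y)) / ‖x - y‖ ^ ((n : ℝ) + s * p) := by
  simp only [reflectedDiff, fracPLapIntegrand, norm_planeReflection_sub he, signedPow]
  ring

theorem reflectedDiff_planeReflection_eq (he : ‖e‖ = 1) (y : EuclideanSpace ℝ (Fin n)) :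
    reflectedDiff s p u e l x (planeReflection e l y) =
      (signedPow p (u (planeReflection e l x) - u y) -
        signedPow p (u x - u (planeReflection e l y))) /
          ‖x - planeReflection e l y‖ ^ ((n : ℝ) + s * p) := by
  rw [reflectedDiff_eq he, planeReflection_involutive he]

theorem norm_sub_lt_norm_sub_planeReflection (he : ‖e‖ = 1) (hx : ⟪e, x⟫ < l)
    {y : EuclideanSpace ℝ (Fin n)} (hy : ⟪e, y⟫ < l) :
    ‖x - y‖ < ‖x - planeReflection e l y‖ := by
  have h := norm_sub_planeReflection_sq he l x y
  have h2 : 0 < (l - ⟪e, x⟫) * (l - ⟪e, y⟫) := mul_pos (by linarith) (by linarith)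
  exact lt_of_pow_lt_pow_left₀ 2 (norm_nonneg _) (by linarith)

/-- The two bounds on the symmetrized integrand at a point where the antisymmetric difference
is minimal and nonpositive. -/
theorem reflectedDiff_add_le (he : ‖e‖ = 1) (hp : 1 < p) (hsp : 0 ≤ (n : ℝ) + s * p)
    (hx : ⟪e, x⟫ < l) (hneg : u (planeReflection e l x) ≤ u x)
    {y : EuclideanSpace ℝ (Fin n)} (hy : ⟪e, y⟫ < l)
    (hmin : u (planeReflection e l x) - u x ≤ u (planeReflection e l y) - u y) (hyx : y ≠ x) :
    reflectedDiff s p u e l x y + reflectedDiff s p u e l x (planeReflection e l y) ≤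
        (signedPow p (u (planeReflection e l x) - u (planeReflection e l y)) -
          signedPow p (u x - u y)) * (1 / ‖x - y‖ ^ ((n : ℝ) + s * p) -
            1 / ‖x - planeReflection e l y‖ ^ ((n : ℝ) + s * p)) ∧
    reflectedDiff s p u e l x y + reflectedDiff s p u e l x (planeReflection e l y) ≤
        (signedPow p (u (planeReflection e l x) - u y) - signedPow p (u x - u y)) /
          ‖x - planeReflection e l y‖ ^ ((n : ℝ) + s * p) ∧
    reflectedDiff s p u e l x y + reflectedDiff s p u e l x (planeReflection e l y) ≤ 0 := by
  rw [reflectedDiff_eq he, reflectedDiff_planeReflection_eq he]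
  set x' := planeReflection e l x
  set y' := planeReflection e l y
  set a := (n : ℝ) + s * p
  have hmono := (strictMono_signedPow hp).monotone
  have hpos : 0 < ‖x - y‖ := norm_pos_iff.2 (sub_ne_zero.2 hyx.symm)
  have hlt : ‖x - y‖ < ‖x - y'‖ := norm_sub_lt_norm_sub_planeReflection he hx hy
  have hk : 1 / ‖x - y'‖ ^ a ≤ 1 / ‖x - y‖ ^ a :=
    one_div_le_one_div_of_le (Real.rpow_pos_of_pos hpos _)
      (Real.rpow_le_rpow hpos.le hlt.le hsp)
  have hk0 : 0 ≤ 1 / ‖x - y'‖ ^ a := by positivity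
  -- With `A`, `B` the numerators at `y` and `y'`, and kernels `k ≥ k'`, the sum is `A * (k - k') +
  -- (A + B) * k'`. Minimality gives `A ≤ 0` (`h1`), and `A + B` regroups into two differences that
  -- are nonpositive because `w x ≤ 0` (`h2`, `h3`). Each bound drops some of these nonpositive
  -- terms.
  have h1 : signedPow p (u x' - u y') ≤ signedPow p (u x - u y) := hmono (by linarith)
  have h2 : signedPow p (u x' - u y') ≤ signedPow p (u x - u y') := hmono (by linarith)
  have h3 : signedPow p (u x' - u y) ≤ signedPow p (u x - u y) := hmono (by linarith)
  simp only [div_eq_mul_inv, one_mul] at hk hk0 ⊢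
  refine ⟨?_, ?_, ?_⟩ <;> nlinarith

/-- The paired sum is invariant under `y ↔ y'`, so the bound below the plane covers both sides. -/
theorem reflectedDiff_add_nonpos (he : ‖e‖ = 1) (hp : 1 < p) (hsp : 0 ≤ (n : ℝ) + s * p)
    (hx : ⟪e, x⟫ < l) (hneg : u (planeReflection e l x) ≤ u x)
    (hmin : ∀ y, ⟪e, y⟫ < l →
      u (planeReflection e l x) - u x ≤ u (planeReflection e l y) - u y)
    {y : EuclideanSpace ℝ (Fin n)} (hyx : y ≠ x) (hyx' : y ≠ planeReflection e l x) :
    reflectedDiff s p u e l x y + reflectedDiff s p u e l x (planeReflection e l y) ≤ 0 := by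
  rcases lt_trichotomy ⟪e, y⟫ l with h | h | h
  · exact (reflectedDiff_add_le he hp hsp hx hneg h (hmin y h) hyx).2.2
  · have h1 : reflectedDiff s p u e l x y ≤ 0 := by
      rw [reflectedDiff_eq he, planeReflection_of_inner_eq h]
      refine div_nonpos_of_nonpos_of_nonneg ?_ (by positivity)
      have := (strictMono_signedPow hp).monotone (sub_le_sub_right hneg (u y))
      linarith
    rw [planeReflection_of_inner_eq h]
    linarith
  · have h' : ⟪e, planeReflection e l y⟫ < l := by rw [inner_planeReflection he]; linarith
    have h2 := (reflectedDiff_add_le (s := s) he hp hsp hx hneg h' (hmin _ h') (fun h3 => hyx' (by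
      rw [← h3, planeReflection_involutive he]))).2.2
    rw [planeReflection_involutive he] at h2
    linarith

theorem preimage_planeReflection_ball (he : ‖e‖ = 1) (z : EuclideanSpace ℝ (Fin n)) (ε : ℝ) :
    planeReflection e l ⁻¹' ball z ε = ball (planeReflection e l z) ε := by
  ext y
  rw [mem_preimage, mem_ball, mem_ball, dist_eq_norm, dist_eq_norm,
    norm_planeReflection_sub' he]

theorem tendsto_volume_ball (he : ‖e‖ = 1) (z : EuclideanSpace ℝ (Fin n)) :
    Tendsto (fun ε : ℝ => volume (ball z ε)) (𝓝[>] 0) (𝓝 0) := by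
  have : Nontrivial (EuclideanSpace ℝ (Fin n)) :=
    nontrivial_of_ne e 0 (by rintro rfl; simp at he)
  have h1 : Tendsto (fun ε : ℝ => ENNReal.ofReal (ε ^ Module.finrank ℝ (EuclideanSpace ℝ (Fin n)))
      * volume (ball (0 : EuclideanSpace ℝ (Fin n)) 1)) (𝓝[>] 0) (𝓝 0) := by
    have h2 : Tendsto (fun ε : ℝ => ε ^ Module.finrank ℝ (EuclideanSpace ℝ (Fin n)))
        (𝓝[>] 0) (𝓝 0) := by
      have := (continuous_pow (M := ℝ)
        (Module.finrank ℝ (EuclideanSpace ℝ (Fin n)))).tendsto 0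
      rw [zero_pow Module.finrank_pos.ne'] at this
      exact this.mono_left nhdsWithin_le_nhds
    have := ENNReal.Tendsto.mul_const (b := volume (ball (0 : EuclideanSpace ℝ (Fin n)) 1))
      (ENNReal.tendsto_ofReal h2) (Or.inr measure_ball_lt_top.ne)
    simpa using this
  refine h1.congr' ?_
  filter_upwards [self_mem_nhdsWithin] with ε hε
  rw [Measure.addHaar_ball volume z (le_of_lt hε)]

theorem integrableOn_reflectedDiff {C L₁ L₂ : ℝ} (he : ‖e‖ = 1)
    (h₁ : HasFracPLaplacianAt C s p u x L₁)
    (h₂ : HasFracPLaplacianAt C s p u (planeReflection e l x) L₂) {ε : ℝ} (hε : 0 < ε) :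
    IntegrableOn (reflectedDiff s p u e l x) (ball x ε)ᶜ := by
  refine IntegrableOn.sub (f := fun y => fracPLapIntegrand s p u (planeReflection e l x)
    (planeReflection e l y)) ?_ (h₁.1 ε hε)
  have := ((measurePreserving_planeReflection he l).integrableOn_comp_preimage
    (measurableEmbedding_planeReflection he l)).2 (h₂.1 ε hε)
  rwa [preimage_compl, preimage_planeReflection_ball he, planeReflection_involutive he] at this

/-- The reflection maps `ball x ε` onto the ball about the reflected point, so the two principal
values can be subtracted under one integral with the same truncation. -/
theorem tendsto_integral_reflectedDiff {C L₁ L₂ : ℝ} (he : ‖e‖ = 1)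
    (h₁ : HasFracPLaplacianAt C s p u x L₁)
    (h₂ : HasFracPLaplacianAt C s p u (planeReflection e l x) L₂) :
    Tendsto (fun ε : ℝ => C * ∫ y in (ball x ε)ᶜ, reflectedDiff s p u e l x y)
      (𝓝[>] 0) (𝓝 (L₂ - L₁)) := by
  refine (h₂.2.sub h₁.2).congr' ?_
  filter_upwards [self_mem_nhdsWithin] with ε hε
  have hpre : planeReflection e l ⁻¹' (ball (planeReflection e l x) ε)ᶜ = (ball x ε)ᶜ := by
    rw [preimage_compl, preimage_planeReflection_ball he, planeReflection_involutive he]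
  have hint := ((measurePreserving_planeReflection he l).integrableOn_comp_preimage
    (measurableEmbedding_planeReflection he l)).2 (h₂.1 ε hε)
  have heq := (measurePreserving_planeReflection he l).setIntegral_preimage_emb
    (measurableEmbedding_planeReflection he l)
    (fracPLapIntegrand s p u (planeReflection e l x)) (ball (planeReflection e l x) ε)ᶜ
  rw [hpre] at hint heq
  rw [← heq, ← mul_sub]
  congr 1
  exact (integral_sub hint (h₁.1 ε hε)).symm

/-- If the symmetrized integrand is nonpositive, and at most `-m` on a set `D`, then the
fractional `p`-Laplacian drops quantitatively between `x` and its reflection. -/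
theorem two_mul_sub_le_neg_measure {C L₁ L₂ m : ℝ} (he : ‖e‖ = 1) (hC : 0 < C)
    (hx : ⟪e, x⟫ < l) (h₁ : HasFracPLaplacianAt C s p u x L₁)
    (h₂ : HasFracPLaplacianAt C s p u (planeReflection e l x) L₂)
    (hle : ∀ y, y ≠ x → y ≠ planeReflection e l x →
      reflectedDiff s p u e l x y + reflectedDiff s p u e l x (planeReflection e l y) ≤ 0)
    {D : Set (EuclideanSpace ℝ (Fin n))} (hD : MeasurableSet D) (hDfin : volume D ≠ ⊤)
    (hm : 0 ≤ m) (hDm : ∀ y ∈ D, y ≠ x → y ≠ planeReflection e l x →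
      reflectedDiff s p u e l x y + reflectedDiff s p u e l x (planeReflection e l y) ≤ -m) :
    2 * (L₂ - L₁) ≤ -(C * m * volume.real D) := by
  set x' := planeReflection e l x with hx'
  set h := reflectedDiff s p u e l x
  have hpos : 0 < ‖x - x'‖ := by
    have := le_norm_sub_planeReflection he l x x
    linarith
  set δ := ‖x - x'‖ / 2 with hδ
  have hδ0 : 0 < δ := half_pos hpos
  have hint : ∀ ε : ℝ, 0 < ε → IntegrableOn h (ball x ε)ᶜ := fun ε hε =>
    integrableOn_reflectedDiff he h₁ h₂ hε
  have hsub : ∀ ε ≤ δ, ball x' ε ⊆ (ball x δ)ᶜ := by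
    intro ε hε y hy hy'
    rw [mem_ball] at hy hy'
    have := dist_triangle_right x x' y
    rw [dist_eq_norm x x', dist_comm x, dist_comm x'] at this
    linarith
  -- Symmetrizing needs a domain invariant under reflection, so the ball about `x'` is removed as
  -- well. This costs nothing in the limit, the integrand being integrable away from `x`.
  have hr : Tendsto (fun ε : ℝ => ∫ y in ball x' ε, h y) (𝓝[>] 0) (𝓝 0) := by
    have h3 := Integrable.tendsto_setIntegral_nhds_zero (hint δ hδ0) (l := 𝓝[>] (0 : ℝ))
      (s := fun ε => ball x' ε) (tendsto_of_tendsto_of_tendsto_of_le_of_le tendsto_const_nhds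
        (tendsto_volume_ball he x') (fun _ => zero_le) (fun _ => Measure.restrict_apply_le _ _))
    refine h3.congr' ?_
    filter_upwards [Ioo_mem_nhdsGT hδ0] with ε hε
    rw [Measure.restrict_restrict measurableSet_ball, inter_eq_left.2 (hsub ε hε.2.le)]
  have hV : ∀ z : EuclideanSpace ℝ (Fin n),
      Tendsto (fun ε : ℝ => volume.real (ball z ε)) (𝓝[>] 0) (𝓝 0) := fun z =>
    (ENNReal.tendsto_toReal ENNReal.zero_ne_top).comp (tendsto_volume_ball he z)
  have hmain : ∀ᶠ ε in 𝓝[>] (0 : ℝ), 2 * ((C * ∫ y in (ball x ε)ᶜ, h y) -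
      C * ∫ y in ball x' ε, h y) ≤
      -(C * m * (volume.real D - volume.real (ball x ε) - volume.real (ball x' ε))) := by
    filter_upwards [Ioo_mem_nhdsGT hδ0] with ε hε
    set A := (ball x ε)ᶜ ∩ (ball x' ε)ᶜ with hA
    have hAm : MeasurableSet A := measurableSet_ball.compl.inter measurableSet_ball.compl
    have hAx : ∀ y ∈ A, y ≠ x ∧ y ≠ x' := by
      rintro y ⟨h3, h4⟩
      constructor <;> rintro rfl
      · exact h3 (mem_ball_self hε.1)
      · exact h4 (mem_ball_self hε.1)
    have hpre : planeReflection e l ⁻¹' A = A := by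
      rw [hA, preimage_inter, preimage_compl, preimage_compl, preimage_planeReflection_ball he,
        preimage_planeReflection_ball he, hx', planeReflection_involutive he, inter_comm]
    have hiA : IntegrableOn h A := (hint ε hε.1).mono_set inter_subset_left
    have hiA' : IntegrableOn (fun y => h (planeReflection e l y)) A := by
      have := ((measurePreserving_planeReflection he l).integrableOn_comp_preimage
        (measurableEmbedding_planeReflection he l)).2 hiA
      rwa [hpre] at this
    have hsplit : ∫ y in (ball x ε)ᶜ, h y = (∫ y in ball x' ε, h y) + ∫ y in A, h y := by
      have hx'sub : ball x' ε ⊆ (ball x ε)ᶜ :=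
        (hsub ε hε.2.le).trans (compl_subset_compl.2 (ball_subset_ball hε.2.le))
      have := integral_inter_add_sdiff (μ := volume) (f := h) (s := (ball x ε)ᶜ)
        (measurableSet_ball (x := x') (ε := ε)) (hint ε hε.1)
      rw [inter_eq_right.2 hx'sub] at this
      rw [← this, sdiff_eq]
    have hsymm : 2 * ∫ y in A, h y = ∫ y in A, (h y + h (planeReflection e l y)) := by
      have := (measurePreserving_planeReflection he l).setIntegral_preimage_emb
        (measurableEmbedding_planeReflection he l) h A
      rw [hpre] at this
      rw [integral_add hiA hiA', this]
      ring
    have hmono : ∫ y in A, (h y + h (planeReflection e l y)) ≤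
        ∫ y in A ∩ D, (h y + h (planeReflection e l y)) := by
      have h3 := integral_inter_add_sdiff (μ := volume) (s := A) hD (hiA.add hiA')
      have h4 : ∫ y in A \ D, (h y + h (planeReflection e l y)) ≤ 0 :=
        setIntegral_nonpos (hAm.diff hD) fun y hy => hle y (hAx y hy.1).1 (hAx y hy.1).2
      simp only [Pi.add_apply] at h3
      linarith
    have hfin : volume (A ∩ D) ≠ ⊤ := measure_ne_top_of_subset inter_subset_right hDfin
    have hbound : ∫ y in A ∩ D, (h y + h (planeReflection e l y)) ≤
        -(m * volume.real (A ∩ D)) := by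
      have h3 := setIntegral_mono_on ((hiA.add hiA').mono_set inter_subset_left)
        (integrableOn_const hfin : IntegrableOn (fun _ => -m) (A ∩ D) volume)
        (hAm.inter hD) (fun y hy => hDm y hy.2 (hAx y hy.1).1 (hAx y hy.1).2)
      rw [setIntegral_const, smul_eq_mul] at h3
      simp only [Pi.add_apply] at h3
      linarith
    have hvol : volume.real D - volume.real (ball x ε) - volume.real (ball x' ε) ≤
        volume.real (A ∩ D) := by
      have h3 : D ⊆ (A ∩ D) ∪ (ball x ε ∪ ball x' ε) := by
        intro y hy
        by_cases h4 : y ∈ ball x ε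
        · exact Or.inr (Or.inl h4)
        · by_cases h5 : y ∈ ball x' ε
          · exact Or.inr (Or.inr h5)
          · exact Or.inl ⟨⟨h4, h5⟩, hy⟩
      have h4 := measureReal_mono h3 (measure_union_ne_top hfin
        (measure_union_ne_top (measure_ball_lt_top (μ := volume)).ne measure_ball_lt_top.ne))
      have h5 := measureReal_union_le (μ := volume) (A ∩ D) (ball x ε ∪ ball x' ε)
      have h6 := measureReal_union_le (μ := volume) (ball x ε) (ball x' ε)
      linarith
    rw [hsplit]
    have h7 : m * (volume.real D - volume.real (ball x ε) - volume.real (ball x' ε)) ≤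
        m * volume.real (A ∩ D) := mul_le_mul_of_nonneg_left hvol hm
    have h8 : 2 * ∫ y in A, h y ≤
        -(m * (volume.real D - volume.real (ball x ε) - volume.real (ball x' ε))) := by linarith
    have h9 := mul_le_mul_of_nonneg_left h8 hC.le
    linarith
  have hlim₁ := ((tendsto_integral_reflectedDiff he h₁ h₂).sub (hr.const_mul C)).const_mul 2
  have hlim₂ := (((tendsto_const_nhds.sub (hV x)).sub (hV x')).const_mul (C * m)).neg
    (f := fun ε : ℝ => C * m * (volume.real D - volume.real (ball x ε) - volume.real (ball x' ε)))
  have := le_of_tendsto_of_tendsto hlim₁ hlim₂ hmain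
  simpa using this

end Symmetrized

/-! ### Maximum principles for antisymmetric differences -/

section MaximumPrinciples

variable {n : ℕ} {C s p q l : ℝ} {u : EuclideanSpace ℝ (Fin n) → ℝ}
  {e x : EuclideanSpace ℝ (Fin n)}

/-- Strong maximum principle: an antisymmetric difference which vanishes at a point where both
fractional `p`-Laplacians agree cannot be positive anywhere. -/
theorem not_lt_of_eq_reflection (he : ‖e‖ = 1) (hC : 0 < C) (hp : 1 < p)
    (hsp : 0 < (n : ℝ) + s * p) (hu : Continuous u) (hx : ⟪e, x⟫ < l) {L : ℝ}
    (h₁ : HasFracPLaplacianAt C s p u x L)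
    (h₂ : HasFracPLaplacianAt C s p u (planeReflection e l x) L)
    (hux : u (planeReflection e l x) = u x)
    (hmin : ∀ y, ⟪e, y⟫ < l → u y ≤ u (planeReflection e l y))
    {y₀ : EuclideanSpace ℝ (Fin n)} (hy₀ : ⟪e, y₀⟫ < l) :
    ¬ u y₀ < u (planeReflection e l y₀) := by
  intro hlt
  have hmin' : ∀ y, ⟪e, y⟫ < l →
      u (planeReflection e l x) - u x ≤ u (planeReflection e l y) - u y := fun y hy => by
    linarith [hmin y hy]
  have hne : y₀ ≠ x := by rintro rfl; linarith
  have hpos : 0 < ‖x - y₀‖ := norm_pos_iff.2 (sub_ne_zero.2 hne.symm)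
  have hlt' := norm_sub_lt_norm_sub_planeReflection he hx hy₀
  have hσ : Continuous (planeReflection e l) :=
    (continuous_planeReflection e).comp (by fun_prop : Continuous fun y => (l, y))
  have hG := continuous_signedPow hp
  -- `B` is the first bound of `reflectedDiff_add_le`. It is continuous and negative at `y₀`, so it
  -- stays below half its value on a small ball, forcing a strict drop although both Laplacians
  -- equal `L`.
  set B : EuclideanSpace ℝ (Fin n) → ℝ := fun y =>
    (signedPow p (u (planeReflection e l x) - u (planeReflection e l y)) -
      signedPow p (u x - u y)) * (1 / ‖x - y‖ ^ ((n : ℝ) + s * p) -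
        1 / ‖x - planeReflection e l y‖ ^ ((n : ℝ) + s * p)) with hB
  have hBcont : ContinuousAt B y₀ := by
    have h1 : ContinuousAt (fun y => signedPow p (u (planeReflection e l x) -
        u (planeReflection e l y)) - signedPow p (u x - u y)) y₀ :=
      ((hG.comp (continuous_const.sub (hu.comp hσ))).sub
        (hG.comp (continuous_const.sub hu))).continuousAt
    have h2 : ContinuousAt (fun y => ‖x - y‖ ^ ((n : ℝ) + s * p)) y₀ :=
      (continuous_const.sub continuous_id).norm.continuousAt.rpow_const (Or.inl hpos.ne')
    have h3 : ContinuousAt (fun y => ‖x - planeReflection e l y‖ ^ ((n : ℝ) + s * p)) y₀ :=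
      (continuous_const.sub hσ).norm.continuousAt.rpow_const (Or.inl (hpos.trans hlt').ne')
    exact h1.mul ((continuousAt_const.div h2 (Real.rpow_pos_of_pos hpos _).ne').sub
      (continuousAt_const.div h3 (Real.rpow_pos_of_pos (hpos.trans hlt') _).ne'))
  have hB0 : B y₀ < 0 := by
    refine mul_neg_of_neg_of_pos ?_ ?_
    · have := strictMono_signedPow hp (a := u (planeReflection e l x) - u (planeReflection e l y₀))
        (b := u x - u y₀) (by linarith)
      linarith
    · exact sub_pos.2 (one_div_lt_one_div_of_lt (Real.rpow_pos_of_pos hpos _)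
        (Real.rpow_lt_rpow hpos.le hlt' hsp))
  have hev : ∀ᶠ y in 𝓝 y₀, B y < B y₀ / 2 ∧ ⟪e, y⟫ < l :=
    (hBcont.eventually_lt_const (by linarith)).and
      (((continuous_const.inner continuous_id).continuousAt (x := y₀)).eventually_lt_const hy₀)
  obtain ⟨ρ, hρ, hball⟩ := Metric.eventually_nhds_iff_ball.1 hev
  have key := two_mul_sub_le_neg_measure he hC hx h₁ h₂
    (fun y h3 h4 => reflectedDiff_add_nonpos he hp hsp.le hx hux.le hmin' h3 h4)
    (D := ball y₀ ρ) measurableSet_ball measure_ball_lt_top.ne (m := -(B y₀ / 2)) (by linarith)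
    (fun y hy hyx _ => by
      have := (reflectedDiff_add_le he hp hsp.le hx hux.le (hball y hy).2
        (hmin' y (hball y hy).2) hyx).1
      have h5 := (hball y hy).1
      simp only [hB] at h5 ⊢
      linarith)
  have hvol : 0 < volume.real (ball y₀ ρ) :=
    ENNReal.toReal_pos (measure_ball_pos volume y₀ hρ).ne' measure_ball_lt_top.ne
  have : 0 < C * -(B y₀ / 2) * volume.real (ball y₀ ρ) :=
    mul_pos (mul_pos hC (by linarith)) hvol
  linarith

/-- Narrow region principle: there is no negative minimum close to both the reflecting plane and
the zero set of `u`. -/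
theorem eventually_no_negative_min_near_zero_set (he : ‖e‖ = 1) (hC : 0 < C) (hs : 0 < s)
    (hp : 1 < p) (hq : p - 1 ≤ q) {U M : ℝ} (hM : 1 ≤ M) (hU : ∀ z, u z ≤ U)
    (hu0 : ∀ z, 0 ≤ u z) :
    ∀ᶠ r in 𝓝[>] (0 : ℝ), ∀ (l : ℝ) (x : EuclideanSpace ℝ (Fin n)), ⟪e, x⟫ < l →
      l - ⟪e, x⟫ ≤ r → u (planeReflection e l x) < u x →
      (∀ y, ⟪e, y⟫ < l →
        u (planeReflection e l x) - u x ≤ u (planeReflection e l y) - u y) →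
      HasFracPLaplacianAt C s p u x (u x ^ q) →
      HasFracPLaplacianAt C s p u (planeReflection e l x) (u (planeReflection e l x) ^ q) →
      ¬ ∀ y ∈ ball (x - (M * r) • e) r, u y = 0 := by
  have hsp0 : 0 < s * p := by positivity
  have hsp : 0 < (n : ℝ) + s * p := by positivity
  set a := (n : ℝ) + s * p with ha
  -- For `y` in the ball, `‖x - y‖ ≤ (M + 1) * r` and `‖y - y'‖ ≤ (2 * M + 4) * r`, so `‖x - y'‖ ≤ N
  -- * r`.
  set N := 3 * M + 5 with hN
  have hN0 : 0 < N := by linarith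
  set V := volume.real (ball (0 : EuclideanSpace ℝ (Fin n)) 1) with hV
  have hV0 : 0 < V :=
    ENNReal.toReal_pos (measure_ball_pos volume _ one_pos).ne' measure_ball_lt_top.ne
  set K := 2 * (q / (p - 1) * U ^ (q - (p - 1))) with hK
  have hlim : Tendsto (fun r : ℝ => C * (N ^ (-a) * V) * r ^ (-(s * p))) (𝓝[>] 0) atTop :=
    (tendsto_rpow_neg_nhdsGT_zero (neg_lt_zero.2 hsp0)).const_mul_atTop
      (mul_pos hC (mul_pos (Real.rpow_pos_of_pos hN0 _) hV0))
  filter_upwards [hlim.eventually_gt_atTop K, self_mem_nhdsWithin] with r hr hr0 l x hx hxr hneg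
    hmin h₁ h₂ hzero
  rw [mem_Ioi] at hr0
  set v := u (planeReflection e l x) with hv
  have hv0 : 0 ≤ v := hu0 _
  have hpow := rpow_sub_rpow_le_mul hp hq hv0 hneg.le (hv0.trans_lt hneg) (hU x)
  have hdiff : 0 < u x ^ (p - 1) - v ^ (p - 1) :=
    sub_pos.2 (Real.rpow_lt_rpow hv0 hneg (by linarith))
  have hD : ∀ y ∈ ball (x - (M * r) • e) r, y ≠ x → y ≠ planeReflection e l x →
      reflectedDiff s p u e l x y + reflectedDiff s p u e l x (planeReflection e l y) ≤
        -((u x ^ (p - 1) - v ^ (p - 1)) / (N * r) ^ a) := by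
    intro y hy hyx _
    have hyr : ‖y - (x - (M * r) • e)‖ < r := by rwa [mem_ball, dist_eq_norm] at hy
    have hin := abs_le.1 ((abs_real_inner_le_norm e (y - (x - (M * r) • e))).trans
      (by rw [he, one_mul]; exact hyr.le : ‖e‖ * ‖y - (x - (M * r) • e)‖ ≤ r))
    rw [inner_sub_right, inner_sub_right, inner_smul_right, real_inner_self_eq_norm_sq, he] at hin
    have hMr : r ≤ M * r := le_mul_of_one_le_left hr0.le hM
    have hyl : ⟪e, y⟫ < l := by linarith
    have hb := (reflectedDiff_add_le he hp hsp.le hx hneg.le hyl (hmin y hyl) hyx).2.1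
    rw [hzero y hy, sub_zero, sub_zero, signedPow_of_nonneg hp hv0,
      signedPow_of_nonneg hp (hu0 x)] at hb
    refine hb.trans ?_
    rw [← neg_div_neg_eq, div_neg, neg_sub]
    refine neg_le_neg ?_
    have hpos : 0 < ‖x - planeReflection e l y‖ :=
      (norm_nonneg _).trans_lt (norm_sub_lt_norm_sub_planeReflection he hx hyl)
    have hdist : ‖x - planeReflection e l y‖ ≤ N * r := by
      have h1 : ‖x - planeReflection e l y‖ ≤ ‖x - y‖ + ‖y - planeReflection e l y‖ := by
        simpa using norm_sub_le_norm_sub_add_norm_sub x y (planeReflection e l y)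
      have h2 : ‖x - y‖ ≤ M * r + r := by
        have h3 : x - y = (M * r) • e - (y - (x - (M * r) • e)) := by abel
        have h4 := norm_sub_le ((M * r) • e) (y - (x - (M * r) • e))
        rw [← h3, norm_smul, he, Real.norm_of_nonneg (by positivity)] at h4
        linarith
      have h5 : ‖y - planeReflection e l y‖ = 2 * (l - ⟪e, y⟫) := by
        rw [planeReflection, sub_add_cancel_left, norm_neg, norm_smul, he,
          Real.norm_of_nonneg (by linarith), mul_one]
      rw [hN]
      linarith
    exact div_le_div_of_nonneg_left hdiff.le (Real.rpow_pos_of_pos hpos _)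
      (Real.rpow_le_rpow hpos.le hdist hsp.le)
  have key := two_mul_sub_le_neg_measure he hC hx h₁ h₂
    (fun y h3 h4 => reflectedDiff_add_nonpos he hp hsp.le hx hneg.le hmin h3 h4)
    measurableSet_ball measure_ball_lt_top.ne (by positivity) hD
  have hvol : volume.real (ball (x - (M * r) • e) r) = r ^ (n : ℝ) * V := by
    rw [measureReal_def, Measure.addHaar_ball_of_pos volume _ hr0, ENNReal.toReal_mul,
      ENNReal.toReal_ofReal (by positivity), finrank_euclideanSpace_fin, Real.rpow_natCast]
    rfl
  -- The volume `r ^ n` against the kernel `r ^ (-(n + s * p))` leaves the divergent factor `r ^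
  -- (-(s * p))`.
  have hscale : (u x ^ (p - 1) - v ^ (p - 1)) / (N * r) ^ a * (r ^ (n : ℝ) * V) =
      (N ^ (-a) * V) * r ^ (-(s * p)) * (u x ^ (p - 1) - v ^ (p - 1)) := by
    rw [show -(s * p) = (n : ℝ) - a by rw [ha]; ring, Real.rpow_sub hr0,
      Real.mul_rpow hN0.le hr0.le, Real.rpow_neg hN0.le]
    field_simp
  rw [hvol, mul_assoc, hscale] at key
  have h6 := mul_lt_mul_of_pos_right hr hdiff
  rw [hK] at h6
  linarith

/-- Quantitative Hopf-type estimate for negative minima near an interior point of the reflecting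
plane. -/
theorem exists_eventually_sub_le_neg_mul (he : ‖e‖ = 1) (hC : 0 < C) (hp : 1 < p)
    (hsp : 0 < (n : ℝ) + s * p) (hu : Continuous u) {l₀ : ℝ}
    {x₀ y₀ : EuclideanSpace ℝ (Fin n)} (hx₀ : ⟪e, x₀⟫ = l₀) (hy₀ : ⟪e, y₀⟫ < l₀)
    (hlt : u y₀ < u (planeReflection e l₀ y₀)) :
    ∃ c > 0, ∀ᶠ z : ℝ × EuclideanSpace ℝ (Fin n) in 𝓝 (l₀, x₀), ∀ L₁ L₂ : ℝ,
      ⟪e, z.2⟫ < z.1 → u (planeReflection e z.1 z.2) ≤ u z.2 →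
      (∀ y, ⟪e, y⟫ < z.1 →
        u (planeReflection e z.1 z.2) - u z.2 ≤ u (planeReflection e z.1 y) - u y) →
      HasFracPLaplacianAt C s p u z.2 L₁ →
      HasFracPLaplacianAt C s p u (planeReflection e z.1 z.2) L₂ →
      L₂ - L₁ ≤ -(c * (z.1 - ⟪e, z.2⟫)) := by
  set b := ((n : ℝ) + s * p) / 2 with hb
  have hb0 : 0 < b := half_pos hsp
  have hσ := continuous_planeReflection e
  have hG := continuous_signedPow hp
  have hne : y₀ ≠ x₀ := by rintro rfl; linarith
  have hσx : planeReflection e l₀ x₀ = x₀ := planeReflection_of_inner_eq hx₀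
  have hpos₀ : 0 < ‖x₀ - planeReflection e l₀ y₀‖ := by
    have := le_norm_sub_planeReflection he l₀ x₀ y₀
    linarith
  -- `ψ` times the distance from `x` to the plane bounds the drop from below: the kernel is the
  -- power `-b` of the squared distance, and the tangent line inequality applies to the exact gap of
  -- squares. At `((l₀, x₀), y₀)` it is positive because `x₀` is fixed by the reflection.
  set ψ : (ℝ × EuclideanSpace ℝ (Fin n)) × EuclideanSpace ℝ (Fin n) → ℝ := fun w =>
    (signedPow p (u w.1.2 - u w.2) - signedPow p (u (planeReflection e w.1.1 w.1.2) -
      u (planeReflection e w.1.1 w.2))) *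
      (b * (‖w.1.2 - planeReflection e w.1.1 w.2‖ ^ 2) ^ (-b - 1) * (4 * (w.1.1 - ⟪e, w.2⟫)))
    with hψ
  have hσ₂ : Continuous fun w : (ℝ × EuclideanSpace ℝ (Fin n)) × EuclideanSpace ℝ (Fin n) =>
      planeReflection e w.1.1 w.2 :=
    hσ.comp (by fun_prop : Continuous fun w : (ℝ × EuclideanSpace ℝ (Fin n)) ×
      EuclideanSpace ℝ (Fin n) => (w.1.1, w.2))
  have hψc : ContinuousAt ψ ((l₀, x₀), y₀) := by
    have h1 : Continuous fun w : (ℝ × EuclideanSpace ℝ (Fin n)) × EuclideanSpace ℝ (Fin n) =>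
        signedPow p (u w.1.2 - u w.2) - signedPow p (u (planeReflection e w.1.1 w.1.2) -
          u (planeReflection e w.1.1 w.2)) :=
      (hG.comp ((hu.comp (by fun_prop)).sub (hu.comp (by fun_prop)))).sub
        (hG.comp ((hu.comp (hσ.comp continuous_fst)).sub (hu.comp hσ₂)))
    have h2 : ContinuousAt (fun w : (ℝ × EuclideanSpace ℝ (Fin n)) × EuclideanSpace ℝ (Fin n) =>
        (‖w.1.2 - planeReflection e w.1.1 w.2‖ ^ 2) ^ (-b - 1)) ((l₀, x₀), y₀) :=
      ((((continuous_snd.comp continuous_fst).sub hσ₂).norm.pow 2).continuousAt).rpow_const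
        (Or.inl (pow_pos hpos₀ 2).ne')
    have h3 : Continuous fun w : (ℝ × EuclideanSpace ℝ (Fin n)) × EuclideanSpace ℝ (Fin n) =>
        4 * (w.1.1 - ⟪e, w.2⟫) :=
      continuous_const.mul ((continuous_fst.comp continuous_fst).sub
        (continuous_const.inner continuous_snd))
    exact h1.continuousAt.mul ((continuousAt_const.mul h2).mul h3.continuousAt)
  have hψ₀ : 0 < ψ ((l₀, x₀), y₀) := by
    refine mul_pos ?_ (mul_pos (mul_pos hb0 (Real.rpow_pos_of_pos (by positivity) _))
      (by simpa using hy₀))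
    simp only [hσx]
    exact sub_pos.2 (strictMono_signedPow hp (by linarith))
  have hev : ∀ᶠ w in 𝓝 ((l₀, x₀), y₀), ψ ((l₀, x₀), y₀) / 2 < ψ w ∧ ⟪e, w.2⟫ < w.1.1 :=
    (hψc.eventually_const_lt (by linarith)).and
      ((continuous_const.inner continuous_snd).continuousAt.eventually_lt
        (continuous_fst.comp continuous_fst).continuousAt hy₀)
  rw [nhds_prod_eq, eventually_prod_iff] at hev
  obtain ⟨pa, hpa, pb, hpb, hab⟩ := hev
  obtain ⟨ρ, hρ, hball⟩ := Metric.eventually_nhds_iff_ball.1 hpb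
  have hvol : 0 < volume.real (ball y₀ ρ) :=
    ENNReal.toReal_pos (measure_ball_pos volume y₀ hρ).ne' measure_ball_lt_top.ne
  refine ⟨C * (ψ ((l₀, x₀), y₀) / 2) * volume.real (ball y₀ ρ) / 2, by positivity, ?_⟩
  filter_upwards [hpa] with z hz L₁ L₂ hx hneg hmin h₁ h₂
  obtain ⟨l, x⟩ := z
  simp only at hx hneg hmin h₁ h₂ ⊢
  have hδ : 0 < l - ⟪e, x⟫ := sub_pos.2 hx
  have key := two_mul_sub_le_neg_measure he hC hx h₁ h₂
    (fun y h3 h4 => reflectedDiff_add_nonpos he hp hsp.le hx hneg hmin h3 h4)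
    (D := ball y₀ ρ) measurableSet_ball measure_ball_lt_top.ne
    (m := ψ ((l₀, x₀), y₀) / 2 * (l - ⟪e, x⟫)) (by positivity)
    (fun y hy hyx _ => by
      obtain ⟨hψy, hyl⟩ := hab hz (hball y hy)
      simp only at hyl
      have h5 := (reflectedDiff_add_le he hp hsp.le hx hneg hyl (hmin y hyl) hyx).1
      refine h5.trans ?_
      have hA : 0 < ‖x - y‖ := norm_pos_iff.2 (sub_ne_zero.2 hyx.symm)
      have hB : 0 < ‖x - planeReflection e l y‖ :=
        hA.trans (norm_sub_lt_norm_sub_planeReflection he hx hyl)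
      have h6 := mul_le_rpow_neg_sub_rpow_neg hb0.le (pow_pos hA 2) (pow_pos hB 2)
      have hpw : ∀ t : ℝ, 0 < t → (t ^ 2) ^ (-b) = 1 / t ^ ((n : ℝ) + s * p) := fun t ht => by
        rw [← Real.rpow_natCast, ← Real.rpow_mul ht.le, one_div, ← Real.rpow_neg ht.le, hb]
        congr 1
        push_cast
        ring
      rw [hpw _ hA, hpw _ hB, norm_sub_planeReflection_sq he l x y, add_sub_cancel_left,
        ← norm_sub_planeReflection_sq he l x y] at h6
      have h7 : signedPow p (u (planeReflection e l x) - u (planeReflection e l y)) ≤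
          signedPow p (u x - u y) :=
        (strictMono_signedPow hp).monotone (by linarith [hmin y hyl])
      have h8 := mul_le_mul_of_nonneg_left h6 (sub_nonneg.2 h7)
      have h9 := mul_le_mul_of_nonneg_right hψy.le hδ.le
      simp only [hψ] at h9 ⊢
      linarith)
  linarith

/-- At a minimum of the antisymmetric difference of a `C^{1,1}` function, the difference is
quadratically small in the distance to the reflecting plane. -/
theorem exists_eventually_abs_sub_le_sq (he : ‖e‖ = 1) (hreg : IsC11Loc u (ball 0 1)) {l₀ : ℝ}
    {x₀ : EuclideanSpace ℝ (Fin n)} (hx₀ : ⟪e, x₀⟫ = l₀) (hx₀1 : x₀ ∈ ball 0 1) :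
    ∃ K : ℝ, 0 ≤ K ∧ ∀ᶠ z : ℝ × EuclideanSpace ℝ (Fin n) in 𝓝 (l₀, x₀), ⟪e, z.2⟫ < z.1 →
      (∀ y, ⟪e, y⟫ < z.1 →
        u (planeReflection e z.1 z.2) - u z.2 ≤ u (planeReflection e z.1 y) - u y) →
      |u (planeReflection e z.1 z.2) - u z.2| ≤ K * (z.1 - ⟪e, z.2⟫) ^ 2 := by
  obtain ⟨K, t, ht, hK⟩ := hreg.2 hx₀1
  rw [isOpen_ball.nhdsWithin_eq hx₀1] at ht
  obtain ⟨ρ, hρ, hball⟩ := Metric.mem_nhds_iff.1 (inter_mem ht (isOpen_ball.mem_nhds hx₀1))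
  -- Criticality gives `|φ' 0| ≤ K * δ`, hence `|φ' ξ| ≤ 3 * K * δ`, over a segment of length `2 *
  -- δ`.
  refine ⟨6 * K, by positivity, ?_⟩
  have hσx : planeReflection e l₀ x₀ = x₀ := planeReflection_of_inner_eq hx₀
  have hev₁ : ∀ᶠ z : ℝ × EuclideanSpace ℝ (Fin n) in 𝓝 (l₀, x₀), z.2 ∈ ball x₀ ρ :=
    continuous_snd.continuousAt.eventually_mem (ball_mem_nhds _ hρ)
  have hev₂ : ∀ᶠ z : ℝ × EuclideanSpace ℝ (Fin n) in 𝓝 (l₀, x₀),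
      planeReflection e z.1 z.2 ∈ ball x₀ ρ :=
    (continuous_planeReflection e).continuousAt.eventually_mem
      (by simpa only [hσx] using ball_mem_nhds x₀ hρ)
  filter_upwards [hev₁, hev₂] with z hz₁ hz₂ hx hmin
  obtain ⟨l, x⟩ := z
  simp only at hz₁ hz₂ hx hmin ⊢
  set δ := l - ⟪e, x⟫ with hδ
  have hδ0 : 0 < δ := sub_pos.2 hx
  have hend : planeReflection e l x = x + (2 * δ) • e := rfl
  have hseg : ∀ τ ∈ Icc 0 (2 * δ), x + τ • e ∈ ball x₀ ρ := by
    intro τ hτ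
    have h1 : x + (τ / (2 * δ)) • ((2 * δ) • e) ∈ segment ℝ x (x + (2 * δ) • e) := by
      rw [segment_eq_image']
      exact ⟨τ / (2 * δ), ⟨by have := hτ.1; positivity, (div_le_one (by linarith)).2 hτ.2⟩, by simp⟩
    rw [smul_smul, div_mul_cancel₀ _ (by positivity)] at h1
    exact (convex_ball x₀ ρ).segment_subset hz₁ (hend ▸ hz₂) h1
  set φ : ℝ → ℝ := fun τ => u (x + τ • e) with hφ
  set φ' : ℝ → ℝ := fun τ => fderiv ℝ u (x + τ • e) e with hφ'
  have hder : ∀ τ ∈ Icc 0 (2 * δ), HasDerivAt φ (φ' τ) τ := by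
    intro τ hτ
    have h1 : DifferentiableAt ℝ u (x + τ • e) :=
      hreg.1.differentiableAt (isOpen_ball.mem_nhds (hball (hseg τ hτ)).2)
    have h2 : HasDerivAt (fun τ : ℝ => x + τ • e) e τ := by
      simpa using ((hasDerivAt_id τ).smul_const e).const_add x
    exact h1.hasFDerivAt.comp_hasDerivAt τ h2
  have hlip : ∀ τ₁ ∈ Icc 0 (2 * δ), ∀ τ₂ ∈ Icc 0 (2 * δ), |φ' τ₁ - φ' τ₂| ≤ K * |τ₁ - τ₂| := by
    intro τ₁ h1 τ₂ h2
    have h3 := hK.norm_sub_le (hball (hseg τ₁ h1)).1 (hball (hseg τ₂ h2)).1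
    rw [add_sub_add_left_eq_sub, ← sub_smul, norm_smul, he, mul_one, Real.norm_eq_abs] at h3
    have h4 := (fderiv ℝ u (x + τ₁ • e) - fderiv ℝ u (x + τ₂ • e)).le_opNorm e
    rw [he, mul_one, Real.norm_eq_abs] at h4
    exact h4.trans h3
  have h0 : (0 : ℝ) ∈ Icc 0 (2 * δ) := ⟨le_rfl, by linarith⟩
  have h2δ : 2 * δ ∈ Icc 0 (2 * δ) := ⟨by linarith, le_rfl⟩
  -- Along `e`, `w` is `φ (2 * δ - τ) - φ τ`, with an interior minimum at `τ = 0`.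
  have hcrit : φ' (2 * δ) = -φ' 0 := by
    have h1 : HasDerivAt (fun τ => φ (2 * δ - τ) - φ τ) (-φ' (2 * δ) - φ' 0) 0 := by
      have h2 : HasDerivAt (fun τ : ℝ => 2 * δ - τ) (-1) 0 := by
        simpa using (hasDerivAt_id (0 : ℝ)).const_sub (2 * δ)
      have h3 : HasDerivAt φ (φ' (2 * δ)) (2 * δ - 0) := by simpa using hder _ h2δ
      have h4 := (HasDerivAt.comp (0 : ℝ) h3 h2).sub (hder 0 h0)
      exact h4.congr_deriv (by ring)
    have hloc : IsLocalMin (fun τ => φ (2 * δ - τ) - φ τ) 0 := by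
      filter_upwards [Iio_mem_nhds hδ0] with τ hτ
      have h2 : ⟪e, x + τ • e⟫ < l := by
        rw [inner_add_right, inner_smul_right, real_inner_self_eq_norm_sq, he]
        rw [mem_Iio] at hτ
        linarith
      have h3 : planeReflection e l (x + τ • e) = x + (2 * δ - τ) • e := by
        rw [planeReflection, inner_add_right, inner_smul_right, real_inner_self_eq_norm_sq, he,
          add_assoc, ← add_smul, hδ]
        ring_nf
      have h4 := hmin _ h2
      rw [h3, hend] at h4
      simpa [hφ] using h4
    linarith [hloc.hasDerivAt_eq_zero h1]
  obtain ⟨ξ, hξ, hslope⟩ := exists_hasDerivAt_eq_slope φ φ' (by linarith : 0 < 2 * δ)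
    (fun τ hτ => (hder τ hτ).continuousAt.continuousWithinAt)
    (fun τ hτ => hder τ (Ioo_subset_Icc_self hτ))
  have hξ0 := abs_le.1 (hlip ξ (Ioo_subset_Icc_self hξ) 0 h0)
  have hends := abs_le.1 (hlip (2 * δ) h2δ 0 h0)
  rw [sub_zero, abs_of_pos hξ.1] at hξ0
  rw [sub_zero, abs_of_pos (by linarith : 0 < 2 * δ)] at hends
  have hKξ : (K : ℝ) * ξ ≤ K * (2 * δ) := by have := hξ.2.le; gcongr
  have hbound : |φ' ξ| ≤ 3 * K * δ := abs_le.2 ⟨by linarith, by linarith⟩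
  have hval : u (planeReflection e l x) - u x = φ' ξ * (2 * δ) := by
    rw [hslope, sub_zero, div_mul_cancel₀ _ (by positivity), hend]
    simp [hφ]
  rw [hval, abs_mul, abs_of_pos (by linarith : 0 < 2 * δ)]
  nlinarith

end MaximumPrinciples

/-! ### Moving planes -/

section MovingPlanes

variable {n : ℕ} {C s p q : ℝ} {u : EuclideanSpace ℝ (Fin n) → ℝ} {e : EuclideanSpace ℝ (Fin n)}

theorem continuous_of_continuousOn_closedBall_of_eq_zero (hcont : ContinuousOn u (closedBall 0 1))
    (hzero : ∀ x ∉ ball (0 : EuclideanSpace ℝ (Fin n)) 1, u x = 0) : Continuous u := by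
  have h1 : ContinuousOn u (ball (0 : EuclideanSpace ℝ (Fin n)) 1)ᶜ :=
    (continuousOn_const (c := (0 : ℝ))).congr hzero
  have h2 := hcont.union_of_isClosed h1 isClosed_closedBall isOpen_ball.isClosed_compl
  rw [← continuousOn_univ]
  refine h2.mono fun x _ => ?_
  by_cases hx : x ∈ ball (0 : EuclideanSpace ℝ (Fin n)) 1
  · exact Or.inl (ball_subset_closedBall hx)
  · exact Or.inr hx

theorem nonneg_of_pos_of_eq_zero
    (hpos : ∀ x ∈ ball (0 : EuclideanSpace ℝ (Fin n)) 1, 0 < u x)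
    (hzero : ∀ x ∉ ball (0 : EuclideanSpace ℝ (Fin n)) 1, u x = 0)
    (x : EuclideanSpace ℝ (Fin n)) : 0 ≤ u x := by
  by_cases hx : x ∈ ball (0 : EuclideanSpace ℝ (Fin n)) 1
  · exact (hpos x hx).le
  · exact (hzero x hx).ge

theorem abs_inner_lt_one (he : ‖e‖ = 1) {x : EuclideanSpace ℝ (Fin n)} (hx : x ∈ ball 0 1) :
    |⟪e, x⟫| < 1 := by
  have := abs_real_inner_le_norm e x
  rw [he, one_mul] at this
  exact this.trans_lt (mem_ball_zero_iff.1 hx)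

/-- The pole `-e` lies on the sphere, where `u = 0`, and reflects into the open ball. It is the
witness that `w` is not identically zero. -/
theorem lt_reflection_neg (he : ‖e‖ = 1) {l : ℝ} (hl : -1 < l) (hl0 : l < 0)
    (hpos : ∀ x ∈ ball (0 : EuclideanSpace ℝ (Fin n)) 1, 0 < u x)
    (hzero : ∀ x ∉ ball (0 : EuclideanSpace ℝ (Fin n)) 1, u x = 0) :
    ⟪e, -e⟫ < l ∧ u (-e) < u (planeReflection e l (-e)) := by
  have h1 : ⟪e, -e⟫ < l := by
    rw [inner_neg_right, real_inner_self_eq_norm_sq, he]; linarith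
  refine ⟨h1, ?_⟩
  rw [hzero (-e) (by simp [he])]
  exact hpos _ (mem_ball_zero_iff.2 (norm_planeReflection_lt_one' he hl0 h1 (by simp [he])))

/-- If `w x = 0`, the equation makes both fractional `p`-Laplacians equal, and the strong maximum
principle contradicts positivity of `w` at `-e`. -/
theorem lt_reflection_of_le (he : ‖e‖ = 1) (hC : 0 < C) (hs : 0 < s) (hp : 1 < p)
    (hu : Continuous u)
    (hpos : ∀ x ∈ ball (0 : EuclideanSpace ℝ (Fin n)) 1, 0 < u x)
    (hzero : ∀ x ∉ ball (0 : EuclideanSpace ℝ (Fin n)) 1, u x = 0)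
    (heq : ∀ x ∈ ball (0 : EuclideanSpace ℝ (Fin n)) 1,
      HasFracPLaplacianAt C s p u x (u x ^ q)) {l : ℝ} (hl0 : l < 0)
    (hP : ∀ y, ⟪e, y⟫ < l → u y ≤ u (planeReflection e l y))
    {x : EuclideanSpace ℝ (Fin n)} (hx : x ∈ ball 0 1) (hxl : ⟪e, x⟫ < l) :
    u x < u (planeReflection e l x) := by
  refine lt_of_le_of_ne (hP x hxl) fun hne => ?_
  have hl : -1 < l := by linarith [(abs_lt.1 (abs_inner_lt_one he hx)).1]
  obtain ⟨h1, h2⟩ := lt_reflection_neg he hl hl0 hpos hzero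
  have hx' : planeReflection e l x ∈ ball 0 1 := mem_ball_zero_iff.2
    (norm_planeReflection_lt_one he hl0.le hxl.le (mem_ball_zero_iff.1 hx))
  have h3 := heq _ hx'
  rw [← hne] at h3
  exact not_lt_of_eq_reflection he hC hp (by positivity) hu hxl (heq x hx) h3 hne.symm hP h1 h2

/-- `x` is a negative minimum in the unit ball of the antisymmetric difference associated with
the hyperplane at height `l`. -/
def IsNegativeMin (u : EuclideanSpace ℝ (Fin n) → ℝ) (e : EuclideanSpace ℝ (Fin n)) (l : ℝ)
    (x : EuclideanSpace ℝ (Fin n)) : Prop :=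
  x ∈ ball 0 1 ∧ ⟪e, x⟫ < l ∧ u (planeReflection e l x) < u x ∧
    ∀ y, ⟪e, y⟫ < l → u (planeReflection e l x) - u x ≤ u (planeReflection e l y) - u y

/-- Outside the ball `w ≥ 0`, and on the plane `w = 0`, so a negative minimum over the compact cap
is global in the half-space and off the plane. -/
theorem exists_isNegativeMin (hu : Continuous u) (hu0 : ∀ x, 0 ≤ u x)
    (hzero : ∀ x ∉ ball (0 : EuclideanSpace ℝ (Fin n)) 1, u x = 0) {l : ℝ}
    {y : EuclideanSpace ℝ (Fin n)} (hy : ⟪e, y⟫ < l) (hlt : u (planeReflection e l y) < u y) :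
    ∃ x, IsNegativeMin u e l x := by
  have hout : ∀ z, u (planeReflection e l z) < u z → z ∈ ball 0 1 := fun z hz => by
    by_contra h
    rw [hzero z h] at hz
    exact absurd (hu0 (planeReflection e l z)) (not_le.2 hz)
  have hσ : Continuous (planeReflection e l) :=
    (continuous_planeReflection e).comp (by fun_prop : Continuous fun y => (l, y))
  have hcl : IsClosed {z : EuclideanSpace ℝ (Fin n) | ⟪e, z⟫ ≤ l} :=
    isClosed_le (continuous_const.inner continuous_id) continuous_const
  obtain ⟨x, hx, hmin⟩ := ((isCompact_closedBall (0 : EuclideanSpace ℝ (Fin n)) 1).inter_right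
    hcl).exists_isMinOn ⟨y, ball_subset_closedBall (hout y hlt), hy.le⟩
    ((hu.comp hσ).sub hu).continuousOn
  rw [isMinOn_iff] at hmin
  simp only [Pi.sub_apply, Function.comp_apply] at hmin
  have hxy := hmin y ⟨ball_subset_closedBall (hout y hlt), hy.le⟩
  have hxneg : u (planeReflection e l x) < u x := by linarith
  refine ⟨x, hout x hxneg, lt_of_le_of_ne hx.2 fun h => ?_, hxneg, fun z hz => ?_⟩
  · rw [planeReflection_of_inner_eq h] at hxneg
    exact lt_irrefl _ hxneg
  · by_cases h : u (planeReflection e l z) < u z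
    · exact hmin z ⟨ball_subset_closedBall (hout z h), hz.le⟩
    · linarith

theorem eventually_not_isNegativeMin_boundary (he : ‖e‖ = 1) (hC : 0 < C) (hs : 0 < s)
    (hp : 1 < p) (hq : p - 1 ≤ q) (hu : Continuous u)
    (hpos : ∀ x ∈ ball (0 : EuclideanSpace ℝ (Fin n)) 1, 0 < u x)
    (hzero : ∀ x ∉ ball (0 : EuclideanSpace ℝ (Fin n)) 1, u x = 0)
    (heq : ∀ x ∈ ball (0 : EuclideanSpace ℝ (Fin n)) 1,
      HasFracPLaplacianAt C s p u x (u x ^ q)) {l₀ : ℝ} (hl₀ : l₀ < 0)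
    {x₀ : EuclideanSpace ℝ (Fin n)} (hx₀ : ‖x₀‖ = 1) (hx₀l : ⟪e, x₀⟫ = l₀) :
    ∀ᶠ z : ℝ × EuclideanSpace ℝ (Fin n) in 𝓝 (l₀, x₀), ¬ IsNegativeMin u e z.1 z.2 := by
  have hu0 := nonneg_of_pos_of_eq_zero hpos hzero
  obtain ⟨U, hU⟩ : ∃ U, ∀ z, u z ≤ U := by
    obtain ⟨U, hU⟩ := (isCompact_closedBall (0 : EuclideanSpace ℝ (Fin n)) 1).bddAbove_image
      hu.continuousOn
    refine ⟨max U 0, fun z => ?_⟩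
    by_cases hz : z ∈ ball (0 : EuclideanSpace ℝ (Fin n)) 1
    · exact (hU (mem_image_of_mem u (ball_subset_closedBall hz))).trans (le_max_left _ _)
    · exact (hzero z hz).le.trans (le_max_right _ _)
  -- As `l₀ < 0`, moving from `x₀` along `-e` leaves the unit ball. `M * -l₀ ≥ 2` and `M ≥ 1` give
  -- `‖x₀ - (M * r) • e‖ ^ 2 ≥ 1 + 4 * r + r ^ 2 > (1 + r) ^ 2`, so the test ball lies where `u =
  -- 0`, also for nearby `x`.
  set M := max 1 (2 / -l₀) with hM
  have hM1 : 1 ≤ M := le_max_left _ _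
  have hM2 : 2 ≤ M * -l₀ := by
    rw [← div_le_iff₀ (by linarith)]
    exact le_max_right _ _
  obtain ⟨r, hr, hr0⟩ := ((eventually_no_negative_min_near_zero_set he hC hs hp hq hM1 hU
    hu0).and self_mem_nhdsWithin).exists
  have hev₁ : ∀ᶠ z : ℝ × EuclideanSpace ℝ (Fin n) in 𝓝 (l₀, x₀), z.1 - ⟪e, z.2⟫ < r :=
    (continuous_fst.sub (continuous_const.inner continuous_snd)).continuousAt.eventually_lt_const
      (by simpa [hx₀l] using hr0)
  have hlim : 1 + r < ‖x₀ - (M * r) • e‖ := by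
    have h1 : ‖x₀ - (M * r) • e‖ ^ 2 = 1 + 2 * r * (M * -l₀) + (M * r) ^ 2 := by
      rw [norm_sub_sq_real, norm_smul, he, inner_smul_right, real_inner_comm, hx₀l, hx₀,
        mul_one, Real.norm_eq_abs, sq_abs]
      ring
    have h2 : r * 2 ≤ r * (M * -l₀) := mul_le_mul_of_nonneg_left hM2 hr0.le
    have h3 : r ≤ M * r := le_mul_of_one_le_left hr0.le hM1
    refine lt_of_pow_lt_pow_left₀ 2 (norm_nonneg _) ?_
    rw [h1]
    nlinarith
  have hev₂ : ∀ᶠ z : ℝ × EuclideanSpace ℝ (Fin n) in 𝓝 (l₀, x₀),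
      1 + r < ‖z.2 - (M * r) • e‖ :=
    (continuous_snd.sub continuous_const).norm.continuousAt.eventually_const_lt hlim
  have hev₃ : ∀ᶠ z : ℝ × EuclideanSpace ℝ (Fin n) in 𝓝 (l₀, x₀), z.1 < 0 :=
    continuous_fst.continuousAt.eventually_lt_const hl₀
  filter_upwards [hev₁, hev₂, hev₃] with z h1 h2 h3
  rintro ⟨hx, hxl, hneg, hmin⟩
  have hx' : planeReflection e z.1 z.2 ∈ ball 0 1 := mem_ball_zero_iff.2
    (norm_planeReflection_lt_one he h3.le hxl.le (mem_ball_zero_iff.1 hx))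
  refine hr z.1 z.2 hxl h1.le hneg hmin (heq _ hx) (heq _ hx') fun y hy => hzero y fun hy1 => ?_
  rw [mem_ball, dist_eq_norm, norm_sub_rev] at hy
  rw [mem_ball_zero_iff] at hy1
  have := norm_sub_norm_le (z.2 - (M * r) • e) y
  linarith

theorem eventually_not_isNegativeMin_interior (he : ‖e‖ = 1) (hC : 0 < C) (hs : 0 < s)
    (hp : 1 < p) (hu : Continuous u) (hreg : IsC11Loc u (ball 0 1))
    (hpos : ∀ x ∈ ball (0 : EuclideanSpace ℝ (Fin n)) 1, 0 < u x)
    (hzero : ∀ x ∉ ball (0 : EuclideanSpace ℝ (Fin n)) 1, u x = 0)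
    (heq : ∀ x ∈ ball (0 : EuclideanSpace ℝ (Fin n)) 1,
      HasFracPLaplacianAt C s p u x (u x ^ q)) {l₀ : ℝ} (hl₀ : l₀ < 0)
    {x₀ : EuclideanSpace ℝ (Fin n)} (hx₀ : x₀ ∈ ball 0 1) (hx₀l : ⟪e, x₀⟫ = l₀) :
    ∀ᶠ z : ℝ × EuclideanSpace ℝ (Fin n) in 𝓝 (l₀, x₀), ¬ IsNegativeMin u e z.1 z.2 := by
  have hl : -1 < l₀ := by linarith [(abs_lt.1 (abs_inner_lt_one he hx₀)).1]
  obtain ⟨hy₁, hy₂⟩ := lt_reflection_neg he hl hl₀ hpos hzero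
  obtain ⟨c, hc, hev₁⟩ := exists_eventually_sub_le_neg_mul (s := s) he hC hp (by positivity) hu
    hx₀l hy₁ hy₂
  obtain ⟨K, hK, hev₂⟩ := exists_eventually_abs_sub_le_sq he hreg hx₀l hx₀
  -- Since `u x₀ > 0`, `t ↦ t ^ q` is Lipschitz near `u x₀` even when `q < 1`. With `δ` the distance
  -- to the plane, the drop is at most `Q * K * δ ^ 2`, yet at least `c * δ`: impossible for small
  -- `δ`.
  obtain ⟨Q, t, ht, hQ⟩ := (Real.hasStrictDerivAt_rpow_const (p := q)
    (Or.inl (hpos x₀ hx₀).ne')).hasStrictFDerivAt.exists_lipschitzOnWith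
  have hev₃ : ∀ᶠ z : ℝ × EuclideanSpace ℝ (Fin n) in 𝓝 (l₀, x₀), u z.2 ∈ t :=
    (hu.comp continuous_snd).continuousAt.eventually_mem ht
  have hev₄ : ∀ᶠ z : ℝ × EuclideanSpace ℝ (Fin n) in 𝓝 (l₀, x₀),
      u (planeReflection e z.1 z.2) ∈ t :=
    (hu.comp (continuous_planeReflection e)).continuousAt.eventually_mem
      (by simpa only [Function.comp_apply, planeReflection_of_inner_eq hx₀l] using ht)
  have hev₅ : ∀ᶠ z : ℝ × EuclideanSpace ℝ (Fin n) in 𝓝 (l₀, x₀),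
      Q * K * (z.1 - ⟪e, z.2⟫) < c :=
    (continuous_const.mul (continuous_fst.sub
      (continuous_const.inner continuous_snd))).continuousAt.eventually_lt_const
      (by simpa [hx₀l] using hc)
  have hev₆ : ∀ᶠ z : ℝ × EuclideanSpace ℝ (Fin n) in 𝓝 (l₀, x₀), z.1 < 0 :=
    continuous_fst.continuousAt.eventually_lt_const hl₀
  filter_upwards [hev₁, hev₂, hev₃, hev₄, hev₅, hev₆] with z h1 h2 h3 h4 h5 h6
  rintro ⟨hx, hxl, hneg, hmin⟩
  have hx' : planeReflection e z.1 z.2 ∈ ball 0 1 := mem_ball_zero_iff.2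
    (norm_planeReflection_lt_one he h6.le hxl.le (mem_ball_zero_iff.1 hx))
  have h7 := h1 _ _ hxl hneg.le hmin (heq _ hx) (heq _ hx')
  have h8 := h2 hxl hmin
  have h9 := (abs_le.1 (hQ.norm_sub_le h4 h3)).1
  rw [Real.norm_eq_abs] at h9
  have hδ : 0 < z.1 - ⟪e, z.2⟫ := sub_pos.2 hxl
  have h10 := mul_le_mul_of_nonneg_left h8 Q.2
  have h11 := mul_lt_mul_of_pos_right h5 hδ
  simp only [NNReal.val_eq_coe] at h10
  nlinarith

theorem eventually_le_reflection (he : ‖e‖ = 1) (hC : 0 < C) (hs : 0 < s)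
    (hp : 1 < p) (hq : p - 1 ≤ q) (hu : Continuous u) (hreg : IsC11Loc u (ball 0 1))
    (hpos : ∀ x ∈ ball (0 : EuclideanSpace ℝ (Fin n)) 1, 0 < u x)
    (hzero : ∀ x ∉ ball (0 : EuclideanSpace ℝ (Fin n)) 1, u x = 0)
    (heq : ∀ x ∈ ball (0 : EuclideanSpace ℝ (Fin n)) 1,
      HasFracPLaplacianAt C s p u x (u x ^ q)) {l₀ : ℝ} (hl₀ : l₀ < 0)
    (hP : ∀ y, ⟪e, y⟫ < l₀ → u y ≤ u (planeReflection e l₀ y)) :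
    ∀ᶠ l in 𝓝 l₀, ∀ y, ⟪e, y⟫ < l → u y ≤ u (planeReflection e l y) := by
  have hu0 := nonneg_of_pos_of_eq_zero hpos hzero
  have hlocal : ∀ x₀ ∈ closedBall (0 : EuclideanSpace ℝ (Fin n)) 1,
      ∀ᶠ z : ℝ × EuclideanSpace ℝ (Fin n) in 𝓝 (l₀, x₀), ¬ IsNegativeMin u e z.1 z.2 := by
    intro x₀ hx₀
    rcases lt_trichotomy ⟪e, x₀⟫ l₀ with h | h | h
    · have hlt : u x₀ < u (planeReflection e l₀ x₀) := by
        by_cases hx : x₀ ∈ ball (0 : EuclideanSpace ℝ (Fin n)) 1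
        · exact lt_reflection_of_le he hC hs hp hu hpos hzero heq hl₀ hP hx h
        · rw [hzero x₀ hx]
          exact hpos _ (mem_ball_zero_iff.2
            (norm_planeReflection_lt_one' he hl₀ h (mem_closedBall_zero_iff.1 hx₀)))
      filter_upwards [(hu.comp continuous_snd).continuousAt.eventually_lt
        (hu.comp (continuous_planeReflection e)).continuousAt hlt] with z hz hbad
      exact lt_asymm hz hbad.2.2.1
    · rcases (mem_closedBall_zero_iff.1 hx₀).lt_or_eq with hx | hx
      · exact eventually_not_isNegativeMin_interior he hC hs hp hu hreg hpos hzero heq hl₀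
          (mem_ball_zero_iff.2 hx) h
      · exact eventually_not_isNegativeMin_boundary he hC hs hp hq hu hpos hzero heq hl₀ hx h
    · filter_upwards [(continuous_fst (X := ℝ)).continuousAt.eventually_lt
        ((continuous_const (y := e)).inner continuous_snd).continuousAt h] with z hz hbad
      exact lt_asymm hz hbad.2.1
  -- Compactness of the closed ball turns the pointwise exclusions into one neighbourhood of `l₀`.
  filter_upwards [(isCompact_closedBall (0 : EuclideanSpace ℝ (Fin n))
    1).eventually_forall_of_forall_eventually
    (P := fun l x => ¬ IsNegativeMin u e l x) hlocal] with l hl y hy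
  by_contra! hlt
  obtain ⟨x, hx⟩ := exists_isNegativeMin hu hu0 hzero hy hlt
  exact hl x (ball_subset_closedBall hx.1) hx

/-- The moving plane argument: the reflection inequality holds up to the central hyperplane. -/
theorem le_reflection (he : ‖e‖ = 1) (hC : 0 < C) (hs : 0 < s)
    (hp : 1 < p) (hq : p - 1 ≤ q) (hu : Continuous u) (hreg : IsC11Loc u (ball 0 1))
    (hpos : ∀ x ∈ ball (0 : EuclideanSpace ℝ (Fin n)) 1, 0 < u x)
    (hzero : ∀ x ∉ ball (0 : EuclideanSpace ℝ (Fin n)) 1, u x = 0)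
    (heq : ∀ x ∈ ball (0 : EuclideanSpace ℝ (Fin n)) 1,
      HasFracPLaplacianAt C s p u x (u x ^ q)) {l : ℝ} (hl : l ∈ Icc (-1 : ℝ) 0)
    {y : EuclideanSpace ℝ (Fin n)} (hy : ⟪e, y⟫ < l) : u y ≤ u (planeReflection e l y) := by
  have hu0 := nonneg_of_pos_of_eq_zero hpos hzero
  set S : Set ℝ := {l | ∀ y, ⟪e, y⟫ < l → u y ≤ u (planeReflection e l y)} with hS
  have hclosed : IsClosed S := by
    rw [← isOpen_compl_iff, isOpen_iff_eventually]
    intro l hl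
    simp only [hS, mem_compl_iff, mem_ofPred_eq, not_forall, not_le] at hl ⊢
    obtain ⟨y, hyl, hlt⟩ := hl
    have hc : Continuous fun l : ℝ => u (planeReflection e l y) :=
      hu.comp ((continuous_planeReflection e).comp (by fun_prop : Continuous fun l : ℝ => (l, y)))
    filter_upwards [lt_mem_nhds hyl, hc.continuousAt.eventually_lt_const hlt] with l' h1 h2
    exact ⟨y, h1, h2⟩
  refine (hclosed.inter isClosed_Icc).Icc_subset_of_forall_mem_nhdsWithin (s := S) ?_ ?_ hl y hy
  · intro y hy
    -- At `l = -1` the half-space misses the ball, so `u y = 0`.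
    rw [hzero y fun h => ?_]
    · exact hu0 _
    · linarith [(abs_lt.1 (abs_inner_lt_one he h)).1]
  · rintro l ⟨hlS, hl⟩
    exact mem_nhdsWithin_of_mem_nhds
      (eventually_le_reflection he hC hs hp hq hu hreg hpos hzero heq hl.2 hlS)

end MovingPlanes

theorem theorem3p1 (n : ℕ) (hn : 1 ≤ n) (C s p q : ℝ) (hC : 0 < C) (hs0 : 0 < s) (hs1 : s < 1)
    (hp : 1 < p) (hq : p - 1 ≤ q)
    (u : EuclideanSpace ℝ (Fin n) → ℝ)
    (hreg : IsC11Loc u (ball 0 1))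
    (hcont : ContinuousOn u (closedBall 0 1))
    (hpos : ∀ x ∈ ball (0 : EuclideanSpace ℝ (Fin n)) 1, 0 < u x)
    (hzero : ∀ x ∉ ball (0 : EuclideanSpace ℝ (Fin n)) 1, u x = 0)
    (heq : ∀ x ∈ ball (0 : EuclideanSpace ℝ (Fin n)) 1,
      HasFracPLaplacianAt C s p u x (u x ^ q)) :
    (∀ x y : EuclideanSpace ℝ (Fin n), ‖x‖ = ‖y‖ → u x = u y) ∧
      (∀ x y : EuclideanSpace ℝ (Fin n), ‖x‖ < 1 → ‖x‖ < ‖y‖ → u y < u x) := by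
  have hu := continuous_of_continuousOn_closedBall_of_eq_zero hcont hzero
  have hle : ∀ x y : EuclideanSpace ℝ (Fin n), ‖x‖ = ‖y‖ → u x ≤ u y := by
    intro x y hxy
    rcases eq_or_ne x y with rfl | hne
    · exact le_rfl
    have hd : 0 < ‖y - x‖ := norm_pos_iff.2 (sub_ne_zero.2 hne.symm)
    -- As `‖x‖ = ‖y‖`, the bisector of `x` and `y` passes through the origin, and reflection across
    -- it swaps them.
    set e := ‖y - x‖⁻¹ • (y - x) with he'
    have he : ‖e‖ = 1 := by
      rw [he', norm_smul, norm_inv, norm_norm, inv_mul_cancel₀ hd.ne']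
    have hin : ⟪y - x, x⟫ = -(‖y - x‖ ^ 2 / 2) := by
      have h1 := norm_sub_sq_real y x
      rw [inner_sub_left, real_inner_self_eq_norm_sq]
      rw [hxy] at h1 ⊢
      linarith
    have hex : ⟪e, x⟫ = -(‖y - x‖ / 2) := by
      rw [he', real_inner_smul_left, hin]
      field_simp
    have hrefl : planeReflection e 0 x = y := by
      rw [planeReflection, hex, he', smul_smul]
      have : 2 * (0 - -(‖y - x‖ / 2)) * ‖y - x‖⁻¹ = 1 := by field_simp; ring
      rw [this, one_smul, add_sub_cancel]
    have := le_reflection he hC hs0 hp hq hu hreg hpos hzero heq (l := 0) (by simp) (y := x)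
      (by rw [hex]; linarith)
    rwa [hrefl] at this
  refine ⟨fun x y h => (hle x y h).antisymm (hle y x h.symm), fun x y hx hxy => ?_⟩
  by_cases hy : y ∈ ball (0 : EuclideanSpace ℝ (Fin n)) 1
  · have hy0 : 0 < ‖y‖ := (norm_nonneg x).trans_lt hxy
    have hy1 := mem_ball_zero_iff.1 hy
    set e := -(‖y‖⁻¹ • y) with he'
    have he : ‖e‖ = 1 := by
      rw [he', norm_neg, norm_smul, norm_inv, norm_norm, inv_mul_cancel₀ hy0.ne']
    have hey : ⟪e, y⟫ = -‖y‖ := by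
      rw [he', inner_neg_left, real_inner_smul_left, real_inner_self_eq_norm_sq]
      field_simp
    -- This plane reflects `y` to the point of norm `‖x‖` on the same ray, where `u` takes the value
    -- `u x` by symmetry.
    set l := -((‖x‖ + ‖y‖) / 2) with hl'
    have hx0 := norm_nonneg x
    have hl0 : l < 0 := by rw [hl']; linarith
    have hl1 : -1 ≤ l := by rw [hl']; linarith
    have hyl : ⟪e, y⟫ < l := by rw [hey, hl']; linarith
    have hlt := lt_reflection_of_le he hC hs0 hp hu hpos hzero heq hl0
      (fun z hz => le_reflection he hC hs0 hp hq hu hreg hpos hzero heq ⟨hl1, hl0.le⟩ hz) hy hyl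
    refine hlt.trans_le (hle _ _ ?_)
    have h1 := norm_planeReflection_sq he l y
    rw [hey, hl'] at h1
    refine (sq_eq_sq₀ (norm_nonneg _) hx0).1 ?_
    rw [hl', h1]
    ring
  · rw [hzero y hy]
    exact hpos x (mem_ball_zero_iff.2 hx)
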